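/- Let $t\ge 1$, $s\ge 0$ and $n\ge 0$ be integers. For $k\in\{0,1,\dots,2t+2s-2\}$ let $n_k=(2t+2s-1)\sum_{i=1}^n i^k$ and let $a_k\in\{0,1,\dots,n_k\}$. For a binary sequence $x=x_1\cdots x_n\in\{0,1\}^n$ let $f(x)=(f(x)_1,\dots,f(x)_n)$ with $f(x)_i=\sum_{j=1}^i x_j$ be its accumulative sequence, and for $z\in\mathbb Z^n$ let $\mathrm{VT}^k(z)=\sum_{i=1}^n i^k z_i$. Call $x$ $t$-good if any two adjacent ones in it, that is, ones at positions $i<j$ with only zeros strictly between them, satisfy $j-i\ge t$. Then the code $$\mathcal C=\{x\in\{0,1\}^n : x \text{ is } t\text{-good and } \mathrm{VT}^k(f(x))\equiv a_k \pmod{n_k+1}\text{ for all } k\in\{0,\dots,2t+2s-2\}\}$$ is a binary $t$-deletion $s$-substitution correcting code: for any two distinct $x,y\in\mathcal C$, no sequence can be obtained both from $x$ and from $y$ by $t$ deletions and $s$ substitutions. Here a deletion removes one symbol of a sequence, a substitution replaces one symbol by a symbol of $\{0,1\}$, possibly by the same one, and the operations may be performed in any order. -/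

import Mathlib

/-- The sequences that can be obtained from `x` after exactly `t` deletions and `s` substitutions,
performed in any order. A deletion removes one symbol; a substitution replaces one symbol `a` by
some symbol `b` of the alphabet, where `b = a` is allowed. -/
inductive ObtainableFrom {α : Type*} (x : List α) : ℕ → ℕ → List α → Prop
  | refl : ObtainableFrom x 0 0 x
  | deletion {t s : ℕ} (u : List α) (a : α) (v : List α)
      (h : ObtainableFrom x t s (u ++ a :: v)) : ObtainableFrom x (t + 1) s (u ++ v)
  | substitution {t s : ℕ} (u : List α) (a b : α) (v : List α)
      (h : ObtainableFrom x t s (u ++ a :: v)) : ObtainableFrom x t (s + 1) (u ++ b :: v)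

/-- The `t`-deletion `s`-substitution ball of the sequence `x = x₁ ⋯ xₙ` over `{0, …, q - 1}`. -/
def errorBall {q n : ℕ} (t s : ℕ) (x : Fin n → Fin q) : Set (List (Fin q)) :=
  {z | ObtainableFrom (List.ofFn x) t s z}

/-- A code of length `n` over `{0, …, q - 1}` corrects `t` deletions and `s` substitutions if the
`t`-deletion `s`-substitution balls of any two distinct codewords are disjoint. -/
def IsDeletionSubstitutionCorrecting {q n : ℕ} (t s : ℕ) (C : Set (Fin n → Fin q)) : Prop :=
  ∀ x ∈ C, ∀ y ∈ C, x ≠ y → Disjoint (errorBall t s x) (errorBall t s y)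

/-- The accumulative sequence `f(x)ᵢ = x₁ + ⋯ + xᵢ`, an integer sequence. -/
def accumulative {q n : ℕ} (x : Fin n → Fin q) : Fin n → ℤ :=
  fun i => ∑ j ∈ Finset.Iic i, ((x j : ℕ) : ℤ)

/-- The `k`-th order VT syndrome `∑ᵢ i ^ k zᵢ`, where `i` runs from `1` to `n`
(the index `i : Fin n` counts from `0`). -/
def vtSyndrome {n : ℕ} (k : ℕ) (z : Fin n → ℤ) : ℤ :=
  ∑ i : Fin n, ((i : ℤ) + 1) ^ k * z i

/-- A binary sequence is `t`-good if the distance between two adjacent (consecutive) ones in it is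
at least `t`. -/
def IsGood {n : ℕ} (t : ℕ) (x : Fin n → Fin 2) : Prop :=
  ∀ i j : Fin n, i < j → x i = 1 → x j = 1 → (∀ l : Fin n, i < l → l < j → x l = 0) →
    (t : ℤ) ≤ (j : ℤ) - (i : ℤ)

/-- The number `n_k = (2t + 2s - 1) ∑ᵢ i ^ k`, where `i` runs from `1` to `n`. -/
def syndromeBound (t s n k : ℕ) : ℤ :=
  (2 * (t : ℤ) + 2 * (s : ℤ) - 1) * ∑ i ∈ Finset.Icc 1 n, (i : ℤ) ^ k

/-- The binary `t`-good sequences `x` of length `n` with `VT^k(f(x)) ≡ a_k` modulo `n_k + 1`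
for all integers `k` with `0 ≤ k ≤ 2t + 2s - 2`. -/
def goodVTCode (t s n : ℕ) (a : ℕ → ℤ) : Set (Fin n → Fin 2) :=
  {x | IsGood t x ∧ ∀ k : ℕ, (k : ℤ) ≤ 2 * (t : ℤ) + 2 * (s : ℤ) - 2 →
    vtSyndrome k (accumulative x) ≡ a k [ZMOD syndromeBound t s n k + 1]}

open Polynomial in
/-- There is an integer polynomial of degree at most `k` that has no root among `0, …, M`, whose
values agree in sign with `d` there, and that has the sign `e` at all later integers. -/
def SignFit (d : ℕ → ℤ) (k M : ℕ) (e : ℤ) : Prop :=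
  ∃ p : ℤ[X], p.natDegree ≤ k ∧ (∀ l : ℕ, l ≤ M → p.eval (l : ℤ) ≠ 0 ∧ 0 ≤ p.eval (l : ℤ) * d l) ∧
    ∀ l : ℕ, M < l → 0 < e * p.eval (l : ℤ)

namespace SignFit

variable {d : ℕ → ℤ} {k M : ℕ} {e : ℤ}

theorem mono {k' : ℕ} (h : SignFit d k M e) (hk : k ≤ k') : SignFit d k' M e := by
  obtain ⟨p, h1, h2, h3⟩ := h
  exact ⟨p, h1.trans hk, h2, h3⟩

theorem zero (hd : d 0 = 0) (he : e = 1 ∨ e = -1) : SignFit d 0 0 e := by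
  refine ⟨Polynomial.C e, by simp, fun l hl => ?_, fun l _ => ?_⟩
  · obtain rfl : l = 0 := by omega
    rcases he with rfl | rfl <;> simp [hd]
  · rcases he with rfl | rfl <;> simp

theorem extend {M' : ℕ} (h : SignFit d k M e) (he : e = 1 ∨ e = -1) (hM : M ≤ M')
    (hM' : M' ≤ M + 1) (hd : 0 ≤ e * d M') : SignFit d k M' e := by
  obtain ⟨p, h1, h2, h3⟩ := h
  refine ⟨p, h1, fun l hl => ?_, fun l hl => h3 l (by omega)⟩
  by_cases hlM : l ≤ M
  · exact h2 l hlM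
  · obtain rfl : l = M' := by omega
    have := h3 l (by omega)
    rcases he with rfl | rfl
    · exact ⟨by intro h; simp [h] at this, mul_nonneg (by linarith) (by linarith)⟩
    · exact ⟨by intro h; simp [h] at this, mul_nonneg_of_nonpos_of_nonpos (by linarith) (by linarith)⟩

theorem flip (h : SignFit d k M e) : SignFit d (k + 1) M (-e) := by
  obtain ⟨p, h1, h2, h3⟩ := h
  have hev : ∀ l : ℕ, (p * (Polynomial.C (2 * (M : ℤ) + 1) - Polynomial.C 2 * Polynomial.X)).eval
      (l : ℤ) = p.eval (l : ℤ) * (2 * M + 1 - 2 * l) := fun l => by simp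
  refine ⟨p * (Polynomial.C (2 * (M : ℤ) + 1) - Polynomial.C 2 * Polynomial.X), ?_,
    fun l hl => ?_, fun l hl => ?_⟩
  · refine Polynomial.natDegree_mul_le.trans (Nat.add_le_add h1 ?_)
    compute_degree
  · have hpos : (0 : ℤ) < 2 * M + 1 - 2 * l := by omega
    rw [hev]
    refine ⟨mul_ne_zero (h2 l hl).1 hpos.ne', ?_⟩
    rw [mul_right_comm]
    exact mul_nonneg (h2 l hl).2 hpos.le
  · have hneg : (0 : ℤ) < -(2 * M + 1 - 2 * l) := by omega
    rw [hev]
    have := mul_pos (h3 l hl) hneg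
    linarith

theorem change {e' : ℤ} (h : SignFit d k M e) (he : e = 1 ∨ e = -1) (he' : e' = 1 ∨ e' = -1) :
    SignFit d (k + 1) M e' := by
  by_cases hee : e' = e
  · subst hee
    exact h.mono (Nat.le_succ k)
  · obtain rfl : e' = -e := by omega
    exact h.flip

theorem eq_zero_of_moments_eq_zero (h : SignFit d k M e)
    (hm : ∀ m ≤ k, ∑ l ∈ Finset.range (M + 1), (l : ℤ) ^ m * d l = 0) {l : ℕ} (hl : l ≤ M) :
    d l = 0 := by
  obtain ⟨p, h1, h2, -⟩ := h
  have hsum : ∑ l ∈ Finset.range (M + 1), p.eval (l : ℤ) * d l = 0 := by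
    simp_rw [Polynomial.eval_eq_sum_range' (Nat.lt_succ_of_le h1), Finset.sum_mul]
    rw [Finset.sum_comm]
    refine Finset.sum_eq_zero fun m hmk => ?_
    simp_rw [mul_assoc]
    rw [← Finset.mul_sum, hm m (Nat.lt_succ_iff.1 (Finset.mem_range.1 hmk)), mul_zero]
  have := (Finset.sum_eq_zero_iff_of_nonneg fun l hl =>
    (h2 l (Nat.lt_succ_iff.1 (Finset.mem_range.1 hl))).2).1 hsum l
      (Finset.mem_range.2 (Nat.lt_succ_of_le hl))
  exact (mul_eq_zero.1 this).resolve_left (h2 l hl).1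

end SignFit

/-- `e` is a sign that all of `c`, and `c - 1` if `0 < o`, and `c + 1` if `o < 0`, weakly have. -/
def IsAdmissibleSign (e c o : ℤ) : Prop :=
  (e = 1 ∧ 0 ≤ c ∧ (0 < o → 1 ≤ c)) ∨ (e = -1 ∧ c ≤ 0 ∧ (o < 0 → c ≤ -1))

theorem IsAdmissibleSign.eq_or {e c o : ℤ} (h : IsAdmissibleSign e c o) : e = 1 ∨ e = -1 :=
  h.imp And.left And.left

theorem exists_isAdmissibleSign (c o : ℤ) : ∃ e, IsAdmissibleSign e c o := by
  unfold IsAdmissibleSign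
  by_cases h : 0 ≤ c ∧ (0 < o → 1 ≤ c)
  · exact ⟨1, Or.inl ⟨rfl, h⟩⟩
  · exact ⟨-1, Or.inr ⟨rfl, by omega, by omega⟩⟩

/-- The lattice paths from the origin that align two sequences with prefix sums `F` and `G`:
`LatticePath F G i j h v u` says that `(i, j)` is reached with `h` horizontal steps, `v` vertical
steps and `u` diagonal steps that need not match. -/
inductive LatticePath (F G : ℕ → ℤ) : ℕ → ℕ → ℕ → ℕ → ℕ → Prop
  | origin : LatticePath F G 0 0 0 0 0
  | diag {i j h v u : ℕ} (hp : LatticePath F G i j h v u)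
      (heq : F (i + 1) - F i = G (j + 1) - G j) : LatticePath F G (i + 1) (j + 1) h v u
  | mismatch {i j h v u : ℕ} (hp : LatticePath F G i j h v u) :
      LatticePath F G (i + 1) (j + 1) h v (u + 1)
  | horizontal {i j h v u : ℕ} (hp : LatticePath F G i j h v u) :
      LatticePath F G (i + 1) j (h + 1) v u
  | vertical {i j h v u : ℕ} (hp : LatticePath F G i j h v u) :
      LatticePath F G i (j + 1) h (v + 1) u

/-- The increments of `F` are nonnegative and those over at most `max t 1` steps are at most `1`. -/
structure HasSparseSteps (t : ℕ) (F : ℕ → ℤ) : Prop where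
  zero : F 0 = 0
  step_nonneg : ∀ i, F i ≤ F (i + 1)
  step_le : ∀ i, F (i + 1) ≤ F i + 1
  window_le : ∀ i j, i ≤ j → j ≤ i + t → F j ≤ F i + 1

theorem HasSparseSteps.le {t : ℕ} {F : ℕ → ℤ} (hF : HasSparseSteps t F) {i j : ℕ} (h : i ≤ j) :
    F i ≤ F j :=
  monotone_nat_of_le_succ hF.step_nonneg h

section Paths

variable {t : ℕ} {F G : ℕ → ℤ}

theorem IsAdmissibleSign.mul_nonneg (hF : HasSparseSteps t F) (hG : HasSparseSteps t G)
    {i j : ℕ} {e : ℤ} (h : IsAdmissibleSign e (F i - G j) (i - j)) (hij : i ≤ j + t)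
    (hji : j ≤ i + t) : 0 ≤ e * (F (max i j) - G (max i j)) := by
  rcases le_total i j with hle | hle
  · rw [max_eq_right hle]
    have h1 := hF.le hle
    have h2 := hF.window_le i j hle hji
    rcases hle.eq_or_lt with rfl | hlt
    · rcases h with ⟨rfl, h⟩ | ⟨rfl, h⟩ <;> omega
    · rcases h with ⟨rfl, h⟩ | ⟨rfl, h⟩ <;> omega
  · rw [max_eq_left hle]
    have h1 := hG.le hle
    have h2 := hG.window_le j i hle hij
    rcases hle.eq_or_lt with rfl | hlt
    · rcases h with ⟨rfl, h⟩ | ⟨rfl, h⟩ <;> omega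
    · rcases h with ⟨rfl, h⟩ | ⟨rfl, h⟩ <;> omega

theorem LatticePath.offset {i j h v u : ℕ} (hp : LatticePath F G i j h v u) : i + v = j + h := by
  induction hp <;> omega

theorem LatticePath.bounds (hF : HasSparseSteps t F) (hG : HasSparseSteps t G) {i j h v u : ℕ}
    (hp : LatticePath F G i j h v u) :
    -((v : ℤ) + u) ≤ F i - G j ∧ F i - G j ≤ h + u := by
  induction hp with
  | origin => simp [hF.zero, hG.zero]
  | diag hp heq ih => omega
  | @mismatch i j h v u hp ih =>
    have := hF.step_nonneg i
    have := hF.step_le i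
    have := hG.step_nonneg j
    have := hG.step_le j
    push_cast
    omega
  | @horizontal i j h v u hp ih =>
    have := hF.step_nonneg i
    have := hF.step_le i
    push_cast
    omega
  | @vertical i j h v u hp ih =>
    have := hG.step_nonneg j
    have := hG.step_le j
    push_cast
    omega

theorem LatticePath.abs_max_le (hF : HasSparseSteps t F) (hG : HasSparseSteps t G)
    {i j h v u : ℕ} (hp : LatticePath F G i j h v u) (hh : h ≤ t) (hv : v ≤ t) :
    |F (max i j) - G (max i j)| ≤ t + u := by
  have ho := hp.offset
  have hb := hp.bounds hF hG
  rw [abs_le]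
  rcases le_total i j with hle | hle
  · rw [max_eq_right hle]
    have h1 := hF.le hle
    have h2 := hF.window_le i j hle (by omega)
    rcases hle.eq_or_lt with rfl | hlt <;> omega
  · rw [max_eq_left hle]
    have h1 := hG.le hle
    have h2 := hG.window_le j i hle (by omega)
    rcases hle.eq_or_lt with rfl | hlt <;> omega

theorem LatticePath.abs_le (hF : HasSparseSteps t F) (hG : HasSparseSteps t G)
    {i j h v u : ℕ} (hp : LatticePath F G i j h v u) :
    h ≤ t → v ≤ t → ∀ l ≤ max i j, |F l - G l| ≤ t + u := by
  induction hp with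
  | origin =>
    intro _ _ l hl
    obtain rfl : l = 0 := by omega
    simp [hF.zero, hG.zero]
  | @diag i j h v u hp heq ih =>
    intro hh hv l hl
    by_cases hlM : l ≤ max i j
    · exact ih hh hv l hlM
    · obtain rfl : l = max (i + 1) (j + 1) := by omega
      exact (hp.diag heq).abs_max_le hF hG hh hv
  | @mismatch i j h v u hp ih =>
    intro hh hv l hl
    by_cases hlM : l ≤ max i j
    · have := ih hh hv l hlM
      push_cast
      omega
    · obtain rfl : l = max (i + 1) (j + 1) := by omega
      exact hp.mismatch.abs_max_le hF hG hh hv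
  | @horizontal i j h v u hp ih =>
    intro hh hv l hl
    by_cases hlM : l ≤ max i j
    · exact ih (by omega) hv l hlM
    · obtain rfl : l = max (i + 1) j := by omega
      exact hp.horizontal.abs_max_le hF hG hh hv
  | @vertical i j h v u hp ih =>
    intro hh hv l hl
    by_cases hlM : l ≤ max i j
    · exact ih hh (by omega) l hlM
    · obtain rfl : l = max i (j + 1) := by omega
      exact hp.vertical.abs_max_le hF hG hh hv

/-- What a lattice path with `K` steps that are no matching diagonal steps yields on the signs
of `d`, when it stops at offset `o` and potential `c` after having passed the indices up to `M`. -/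
structure PathSigns (d : ℕ → ℤ) (K M : ℕ) (c o : ℤ) : Prop where
  of_ne : o ≠ 0 → 1 ≤ K ∧ ∃ e, IsAdmissibleSign e c o ∧ SignFit d (K - 1) M e
  of_eq : o = 0 → ∃ e, IsAdmissibleSign e c o ∧ SignFit d (K - 2) M e
  of_le_one : o = 0 → K ≤ 1 → ∀ e, IsAdmissibleSign e c o → SignFit d 0 M e
  of_zero : K = 0 → c = 0

theorem PathSigns.exists_signFit {d : ℕ → ℤ} {K M : ℕ} {c o : ℤ} (h : PathSigns d K M c o)
    (hK : 1 ≤ K) : ∃ e, IsAdmissibleSign e c o ∧ SignFit d (K - 1) M e := by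
  by_cases ho : o = 0
  · obtain ⟨e, he, hs⟩ := h.of_eq ho
    exact ⟨e, he, hs.mono (by omega)⟩
  · exact (h.of_ne ho).2

theorem PathSigns.diag {d : ℕ → ℤ} {K M M' : ℕ} {c o : ℤ} (h : PathSigns d K M c o)
    (hM : M ≤ M') (hM' : M' ≤ M + 1) (hd : ∀ e, IsAdmissibleSign e c o → 0 ≤ e * d M') :
    PathSigns d K M' c o where
  of_ne ho := by
    obtain ⟨hK, e, he, hs⟩ := h.of_ne ho
    exact ⟨hK, e, he, hs.extend he.eq_or hM hM' (hd e he)⟩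
  of_eq ho := by
    obtain ⟨e, he, hs⟩ := h.of_eq ho
    exact ⟨e, he, hs.extend he.eq_or hM hM' (hd e he)⟩
  of_le_one ho hK e he := (h.of_le_one ho hK e he).extend he.eq_or hM hM' (hd e he)
  of_zero := h.of_zero

theorem PathSigns.break {d : ℕ → ℤ} {K M M' : ℕ} {c o c' o' : ℤ} (h : PathSigns d K M c o)
    (hM : M ≤ M') (hM' : M' ≤ M + 1) (hd : ∀ e, IsAdmissibleSign e c' o' → 0 ≤ e * d M')
    (hstep : o' = o ∧ c - 1 ≤ c' ∧ c' ≤ c + 1 ∨ o' = o + 1 ∧ c ≤ c' ∧ c' ≤ c + 1 ∨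
      o' = o - 1 ∧ c - 1 ≤ c' ∧ c' ≤ c) : PathSigns d (K + 1) M' c' o' where
  of_ne ho := by
    refine ⟨by omega, ?_⟩
    obtain ⟨e', he'⟩ := exists_isAdmissibleSign c' o'
    refine ⟨e', he', SignFit.extend ?_ he'.eq_or hM hM' (hd e' he')⟩
    rcases Nat.eq_zero_or_pos K with rfl | hK
    · have ho0 : o = 0 := by
        by_contra hne
        exact absurd (h.of_ne hne).1 (by omega)
      refine h.of_le_one ho0 (by omega) e' ?_
      have hc := h.of_zero rfl
      have := he'.eq_or
      unfold IsAdmissibleSign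
      omega
    · obtain ⟨e, he, hs⟩ := h.exists_signFit hK
      exact (hs.change he.eq_or he'.eq_or).mono (by omega)
  of_eq ho' := by
    by_cases ho : o = 0
    · by_cases hK : K ≤ 1
      · obtain ⟨e, he, he'⟩ : ∃ e, IsAdmissibleSign e c o ∧ IsAdmissibleSign e c' o' := by
          unfold IsAdmissibleSign
          by_cases hc : 0 ≤ c ∧ 0 ≤ c'
          · exact ⟨1, by omega⟩
          · exact ⟨-1, by omega⟩
        exact ⟨e, he', ((h.of_le_one ho hK e he).extend he.eq_or hM hM' (hd e he')).mono
          (Nat.zero_le _)⟩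
      · obtain ⟨e, he, hs⟩ := h.of_eq ho
        obtain ⟨e', he'⟩ := exists_isAdmissibleSign c' o'
        exact ⟨e', he', ((hs.change he.eq_or he'.eq_or).extend he'.eq_or hM hM' (hd e' he')).mono
          (by omega)⟩
    · obtain ⟨hK, e, he, hs⟩ := h.of_ne ho
      have he' : IsAdmissibleSign e c' o' := by
        unfold IsAdmissibleSign at he ⊢
        omega
      exact ⟨e, he', (hs.extend he.eq_or hM hM' (hd e he')).mono (by omega)⟩
  of_le_one ho' hK e he' := by
    obtain rfl : K = 0 := by omega
    have ho : o = 0 := by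
      by_contra hne
      exact absurd (h.of_ne hne).1 (by omega)
    refine (h.of_le_one ho (by omega) e ?_).extend he'.eq_or hM hM' (hd e he')
    have hc := h.of_zero rfl
    have := he'.eq_or
    unfold IsAdmissibleSign
    omega
  of_zero hK := by omega

theorem LatticePath.pathSigns (hF : HasSparseSteps t F) (hG : HasSparseSteps t G)
    {i j h v u : ℕ} (hp : LatticePath F G i j h v u) : h ≤ t → v ≤ t →
      PathSigns (fun l => F l - G l) (h + v + u) (max i j) (F i - G j) (i - j) := by
  induction hp with
  | origin =>
    intro _ _
    have hs : ∀ e : ℤ, e = 1 ∨ e = -1 → SignFit (fun l => F l - G l) 0 0 e :=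
      fun e he => SignFit.zero (by simp [hF.zero, hG.zero]) he
    exact ⟨by simp, fun _ => ⟨1, by simp [IsAdmissibleSign, hF.zero, hG.zero], hs 1 (Or.inl rfl)⟩,
      fun _ _ e he => hs e he.eq_or, fun _ => by simp [hF.zero, hG.zero]⟩
  | @diag i j h v u hp heq ih =>
    intro hh hv
    have ho := hp.offset
    have hadm : ∀ e, IsAdmissibleSign e (F (i + 1) - G (j + 1)) (((i + 1 : ℕ) : ℤ) - (j + 1 : ℕ)) →
        0 ≤ e * (F (max (i + 1) (j + 1)) - G (max (i + 1) (j + 1))) :=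
      fun e he => he.mul_nonneg hF hG (by omega) (by omega)
    have hc : F (i + 1) - G (j + 1) = F i - G j := by omega
    have ho : ((i + 1 : ℕ) : ℤ) - (j + 1 : ℕ) = i - j := by omega
    rw [hc, ho] at hadm ⊢
    exact (ih hh hv).diag (by omega) (by omega) hadm
  | @mismatch i j h v u hp ih =>
    intro hh hv
    have ho := hp.offset
    have h1 := hF.step_nonneg i
    have h2 := hF.step_le i
    have h3 := hG.step_nonneg j
    have h4 := hG.step_le j
    exact (ih hh hv).break (by omega) (by omega)
      (fun e he => he.mul_nonneg hF hG (by omega) (by omega)) (by omega)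
  | @horizontal i j h v u hp ih =>
    intro hh hv
    have ho := hp.offset
    have h1 := hF.step_nonneg i
    have h2 := hF.step_le i
    rw [show h + 1 + v + u = h + v + u + 1 by omega]
    exact (ih (by omega) hv).break (by omega) (by omega)
      (fun e he => he.mul_nonneg hF hG (by omega) (by omega)) (by omega)
  | @vertical i j h v u hp ih =>
    intro hh hv
    have ho := hp.offset
    have h1 := hG.step_nonneg j
    have h2 := hG.step_le j
    rw [show h + (v + 1) + u = h + v + u + 1 by omega]
    exact (ih hh (by omega)).break (by omega) (by omega)
      (fun e he => he.mul_nonneg hF hG (by omega) (by omega)) (by omega)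

end Paths

section Alignments

variable {α : Type*}

/-- `z` arises from the first sequence by deleting `h` symbols and altering at most `u` others. -/
inductive Edits : List α → List α → ℕ → ℕ → Prop
  | nil (u : ℕ) : Edits [] [] 0 u
  | keep (a : α) {x z : List α} {h u : ℕ} (hx : Edits x z h u) : Edits (a :: x) (a :: z) h u
  | subst (a b : α) {x z : List α} {h u : ℕ} (hx : Edits x z h u) :
      Edits (a :: x) (b :: z) h (u + 1)
  | delete (a : α) {x z : List α} {h u : ℕ} (hx : Edits x z h u) : Edits (a :: x) z (h + 1) u

namespace Edits

theorem refl : ∀ x : List α, Edits x x 0 0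
  | [] => nil 0
  | a :: x => (refl x).keep a

theorem succ {x z : List α} {h u : ℕ} (hx : Edits x z h u) : Edits x z h (u + 1) := by
  induction hx with
  | nil u => exact nil _
  | keep a _ ih => exact ih.keep a
  | subst a b _ ih => exact ih.subst a b
  | delete a _ ih => exact ih.delete a

theorem deletion {x w : List α} {h u : ℕ} (hx : Edits x w h u) :
    ∀ (p : List α) (a : α) (q : List α), w = p ++ a :: q → Edits x (p ++ q) (h + 1) u := by
  induction hx with
  | nil u => intro p a q hw; simp at hw
  | keep c hx ih =>
    intro p a q hw
    cases p with
    | nil =>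
      obtain ⟨rfl, rfl⟩ := List.cons.inj hw
      exact hx.delete _
    | cons b p =>
      obtain ⟨rfl, hz⟩ := List.cons.inj hw
      exact (ih p a q hz).keep _
  | subst c b hx ih =>
    intro p a q hw
    cases p with
    | nil =>
      obtain ⟨rfl, rfl⟩ := List.cons.inj hw
      exact hx.succ.delete _
    | cons b p =>
      obtain ⟨rfl, hz⟩ := List.cons.inj hw
      exact (ih p a q hz).subst _ _
  | delete c hx ih => exact fun p a q hw => (ih p a q hw).delete c

theorem substitution {x w : List α} {h u : ℕ} (hx : Edits x w h u) :
    ∀ (p : List α) (a b : α) (q : List α), w = p ++ a :: q → Edits x (p ++ b :: q) h (u + 1) := by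
  induction hx with
  | nil u => intro p a b q hw; simp at hw
  | keep c hx ih =>
    intro p a b q hw
    cases p with
    | nil =>
      obtain ⟨rfl, rfl⟩ := List.cons.inj hw
      exact hx.subst _ _
    | cons c' p =>
      obtain ⟨rfl, hz⟩ := List.cons.inj hw
      exact (ih p a b q hz).keep _
  | subst c c' hx ih =>
    intro p a b q hw
    cases p with
    | nil =>
      obtain ⟨rfl, rfl⟩ := List.cons.inj hw
      exact hx.succ.subst _ _
    | cons c' p =>
      obtain ⟨rfl, hz⟩ := List.cons.inj hw
      exact (ih p a b q hz).subst _ _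
  | delete c hx ih => exact fun p a b q hw => (ih p a b q hw).delete c

end Edits

theorem ObtainableFrom.edits {x z : List α} {t s : ℕ} (h : ObtainableFrom x t s z) :
    Edits x z t s := by
  induction h with
  | refl => exact Edits.refl x
  | deletion p a q _ ih => exact ih.deletion p a q rfl
  | substitution p a b q _ ih => exact ih.substitution p a b q rfl

/-- An alignment of two sequences that leaves `h` symbols of the first and `v` symbols of the
second unaligned and aligns at most `u` pairs of symbols that may differ. -/
inductive PairAlignment : List α → List α → ℕ → ℕ → ℕ → Prop
  | nil (u : ℕ) : PairAlignment [] [] 0 0 u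
  | diag (a : α) {x y : List α} {h v u : ℕ} (hx : PairAlignment x y h v u) :
      PairAlignment (a :: x) (a :: y) h v u
  | mismatch (a b : α) {x y : List α} {h v u : ℕ} (hx : PairAlignment x y h v u) :
      PairAlignment (a :: x) (b :: y) h v (u + 1)
  | left (a : α) {x y : List α} {h v u : ℕ} (hx : PairAlignment x y h v u) :
      PairAlignment (a :: x) y (h + 1) v u
  | right (b : α) {x y : List α} {h v u : ℕ} (hx : PairAlignment x y h v u) :
      PairAlignment x (b :: y) h (v + 1) u

theorem PairAlignment.succ {x y : List α} {h v u : ℕ} (hx : PairAlignment x y h v u) :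
    PairAlignment x y h v (u + 1) := by
  induction hx with
  | nil u => exact nil _
  | diag a _ ih => exact ih.diag a
  | mismatch a b _ ih => exact ih.mismatch a b
  | left a _ ih => exact ih.left a
  | right a _ ih => exact ih.right a

theorem Edits.alignment {x z : List α} {h u : ℕ} (hx : Edits x z h u) :
    ∀ {y : List α} {v w : ℕ}, Edits y z v w → PairAlignment x y h v (u + w) := by
  induction hx with
  | nil u =>
    intro y v w hy
    generalize hz : ([] : List α) = z at hy
    induction hy with
    | nil w => exact PairAlignment.nil _
    | keep => simp at hz
    | subst => simp at hz
    | delete b _ ih => exact (ih hz).right b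
  | @keep a x z h u hx ih =>
    intro y v w hy
    generalize hz : a :: z = z' at hy
    induction hy with
    | nil => simp at hz
    | keep b hy _ =>
      obtain ⟨rfl, rfl⟩ := List.cons.inj hz
      exact (ih hy).diag _
    | subst c b hy _ =>
      obtain ⟨rfl, rfl⟩ := List.cons.inj hz
      exact (ih hy).mismatch _ _
    | delete b _ ih' => exact (ih' hz).right b
  | @subst a b x z h u hx ih =>
    intro y v w hy
    generalize hz : b :: z = z' at hy
    induction hy with
    | nil => simp at hz
    | @keep c y z v w hy _ =>
      obtain ⟨rfl, rfl⟩ := List.cons.inj hz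
      rw [show u + 1 + w = u + w + 1 by omega]
      exact (ih hy).mismatch _ _
    | @subst c c' y z v w hy _ =>
      obtain ⟨rfl, rfl⟩ := List.cons.inj hz
      rw [show u + 1 + (w + 1) = u + w + 1 + 1 by omega]
      exact (ih hy).succ.mismatch _ _
    | delete b _ ih' => exact (ih' hz).right b
  | delete a hx ih => exact fun hy => (ih hy).left a

/-- The sum of the images under `φ` of the first `i` symbols. -/
def prefixSum (φ : α → ℤ) (x : List α) (i : ℕ) : ℤ :=
  ((x.map φ).take i).sum

theorem prefixSum_append_cons (φ : α → ℤ) (p : List α) (a : α) (x : List α) :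
    prefixSum φ (p ++ a :: x) (p.length + 1) - prefixSum φ (p ++ a :: x) p.length = φ a := by
  have h : (p.map φ).take (p.length + 1) = p.map φ := List.take_of_length_le (by simp)
  simp [prefixSum, List.take_append, h]

theorem PairAlignment.latticePath (φ : α → ℤ) {x y : List α} {h v u : ℕ}
    (hx : PairAlignment x y h v u) : ∀ (p q : List α) (h₀ v₀ u₀ : ℕ),
    LatticePath (prefixSum φ (p ++ x)) (prefixSum φ (q ++ y)) p.length q.length h₀ v₀ u₀ →
    ∃ u' ≤ u₀ + u, LatticePath (prefixSum φ (p ++ x)) (prefixSum φ (q ++ y)) (p ++ x).length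
      (q ++ y).length (h₀ + h) (v₀ + v) u' := by
  induction hx with
  | nil u => exact fun p q h₀ v₀ u₀ hp => ⟨u₀, by omega, by simpa using hp⟩
  | diag a _ ih =>
    intro p q h₀ v₀ u₀ hp
    have := ih (p ++ [a]) (q ++ [a]) h₀ v₀ u₀
    simp only [List.append_assoc, List.singleton_append, List.length_append, List.length_singleton]
      at this
    simpa using this (hp.diag (by rw [prefixSum_append_cons, prefixSum_append_cons]))
  | @mismatch a b x y h v u _ ih =>
    intro p q h₀ v₀ u₀ hp
    have := ih (p ++ [a]) (q ++ [b]) h₀ v₀ (u₀ + 1)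
    simp only [List.append_assoc, List.singleton_append, List.length_append, List.length_singleton]
      at this
    obtain ⟨u', hu, h'⟩ := this hp.mismatch
    exact ⟨u', by omega, by simpa using h'⟩
  | @left a x y h v u _ ih =>
    intro p q h₀ v₀ u₀ hp
    have := ih (p ++ [a]) q (h₀ + 1) v₀ u₀
    simp only [List.append_assoc, List.singleton_append, List.length_append, List.length_singleton]
      at this
    obtain ⟨u', hu, h'⟩ := this hp.horizontal
    exact ⟨u', hu, by simpa [add_assoc, add_comm 1] using h'⟩
  | @right b x y h v u _ ih =>
    intro p q h₀ v₀ u₀ hp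
    have := ih p (q ++ [b]) h₀ (v₀ + 1) u₀
    simp only [List.append_assoc, List.singleton_append, List.length_append, List.length_singleton]
      at this
    obtain ⟨u', hu, h'⟩ := this hp.vertical
    exact ⟨u', hu, by simpa [add_assoc, add_comm 1] using h'⟩

end Alignments

section Codes

variable {n : ℕ}

/-- The prefix sums of a binary sequence, extended by its weight beyond its end. -/
def onesBefore (x : Fin n → Fin 2) : ℕ → ℤ :=
  prefixSum (fun a : Fin 2 => ((a : ℕ) : ℤ)) (List.ofFn x)

theorem onesBefore_eq_sum (x : Fin n → Fin 2) (i : ℕ) :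
    onesBefore x i = ∑ j : Fin n with j.val < i, ((x j : ℕ) : ℤ) := by
  rw [onesBefore, prefixSum, List.map_ofFn, List.sum_take_ofFn]
  rfl

theorem accumulative_eq_onesBefore (x : Fin n → Fin 2) (i : Fin n) :
    accumulative x i = onesBefore x (i + 1) := by
  rw [accumulative, onesBefore_eq_sum]
  refine Finset.sum_congr (Finset.ext fun j => ?_) fun _ _ => rfl
  simp only [Finset.mem_Iic, Finset.mem_filter, Finset.mem_univ, true_and, Fin.le_def]
  omega

theorem onesBefore_add_window (x : Fin n → Fin 2) {i j : ℕ} (hij : i ≤ j) :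
    onesBefore x j =
      onesBefore x i + (Finset.univ.filter fun l : Fin n => (i ≤ l.val ∧ l.val < j) ∧ x l = 1).card := by
  have hcard : ((Finset.univ.filter fun l : Fin n => (i ≤ l.val ∧ l.val < j) ∧ x l = 1).card : ℤ) =
      ∑ l : Fin n with i ≤ l.val ∧ l.val < j, ((x l : ℕ) : ℤ) := by
    rw [← Finset.filter_filter, Finset.card_filter]
    push_cast
    refine Finset.sum_congr rfl fun l _ => ?_
    have : x l = 0 ∨ x l = 1 := by omega
    rcases this with h | h <;> simp [h]
  rw [hcard, onesBefore_eq_sum, onesBefore_eq_sum, ← Finset.sum_union]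
  · congr 1
    ext l
    simp
    omega
  · rw [Finset.disjoint_left]
    intro l
    simp
    omega

theorem IsGood.add_le {t : ℕ} {x : Fin n → Fin 2} (hx : IsGood t x) {i j : Fin n} (hij : i < j)
    (hi : x i = 1) (hj : x j = 1) : (i : ℕ) + t ≤ j := by
  induction j using WellFoundedLT.induction with
  | ind j ih =>
    by_cases h : ∃ l, i < l ∧ l < j ∧ x l = 1
    · obtain ⟨l, hil, hlj, hl⟩ := h
      have := ih l hlj hil hl
      omega
    · push Not at h
      have := hx i j hij hi hj fun l hil hlj => by
        have := h l hil hlj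
        omega
      omega

theorem IsGood.hasSparseSteps {t : ℕ} {x : Fin n → Fin 2} (hx : IsGood t x) :
    HasSparseSteps t (onesBefore x) where
  zero := by simp [onesBefore, prefixSum]
  step_nonneg i := by
    rw [onesBefore_add_window x (Nat.le_succ i)]
    omega
  step_le i := by
    rw [onesBefore_add_window x (Nat.le_succ i), add_le_add_iff_left, Nat.cast_le_one,
      Finset.card_le_one]
    simp only [Finset.mem_filter, Finset.mem_univ, true_and]
    intro a ha b hb
    omega
  window_le i j hij hji := by
    rw [onesBefore_add_window x hij, add_le_add_iff_left, Nat.cast_le_one, Finset.card_le_one]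
    simp only [Finset.mem_filter, Finset.mem_univ, true_and]
    rintro a ⟨ha, ha'⟩ b ⟨hb, hb'⟩
    rcases lt_trichotomy a b with h | h | h
    · have := hx.add_le h ha' hb'
      omega
    · exact h
    · have := hx.add_le h hb' ha'
      omega

theorem eq_of_onesBefore_sub_eq_zero {x y : Fin n → Fin 2}
    (h : ∀ l ≤ n, onesBefore x l - onesBefore y l = 0) : x = y := by
  funext i
  have hsum : ∀ z : Fin n → Fin 2, onesBefore z (i + 1) = onesBefore z i + (z i : ℕ) := by
    intro z
    rw [onesBefore_eq_sum, onesBefore_eq_sum, show (Finset.univ.filter fun j : Fin n =>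
      j.val < i.val + 1) = insert i (Finset.univ.filter fun j : Fin n => j.val < i.val) by
        ext j; simp [Fin.ext_iff]; omega, Finset.sum_insert (by simp)]
    ring
  have h1 := h i (by omega)
  have h2 := h (i + 1) (by omega)
  rw [hsum, hsum] at h2
  omega

theorem vtSyndrome_sub_eq_sum (k : ℕ) (x y : Fin n → Fin 2) :
    vtSyndrome k (accumulative x) - vtSyndrome k (accumulative y) =
      ∑ l ∈ Finset.range (n + 1), (l : ℤ) ^ k * (onesBefore x l - onesBefore y l) := by
  have h0 : ∀ z : Fin n → Fin 2, onesBefore z 0 = 0 := fun z => by simp [onesBefore, prefixSum]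
  rw [Finset.sum_range_succ', h0, h0, sub_self, mul_zero, add_zero, vtSyndrome, vtSyndrome,
    ← Finset.sum_sub_distrib, Finset.sum_range]
  refine Finset.sum_congr rfl fun i _ => ?_
  rw [accumulative_eq_onesBefore, accumulative_eq_onesBefore]
  push_cast
  ring

theorem abs_vtSyndrome_sub_le {x y : Fin n → Fin 2} {B : ℤ} (k : ℕ)
    (h : ∀ l ≤ n, |onesBefore x l - onesBefore y l| ≤ B) :
    |vtSyndrome k (accumulative x) - vtSyndrome k (accumulative y)| ≤
      B * ∑ i ∈ Finset.Icc 1 n, (i : ℤ) ^ k := by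
  have hIcc : ∑ i ∈ Finset.Icc 1 n, (i : ℤ) ^ k = ∑ i : Fin n, ((i : ℤ) + 1) ^ k := by
    rw [← Finset.Ico_add_one_right_eq_Icc, Finset.sum_Ico_eq_sum_range, Finset.sum_range]
    simp [add_comm]
  rw [hIcc, vtSyndrome, vtSyndrome, ← Finset.sum_sub_distrib, Finset.mul_sum]
  refine (Finset.abs_sum_le_sum_abs _ _).trans (Finset.sum_le_sum fun i _ => ?_)
  have hpos : (0 : ℤ) ≤ ((i : ℤ) + 1) ^ k := by positivity
  rw [← mul_sub, abs_mul, abs_of_nonneg hpos, mul_comm, accumulative_eq_onesBefore,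
    accumulative_eq_onesBefore]
  exact mul_le_mul_of_nonneg_right (h _ (by omega)) hpos

theorem exists_latticePath {t s : ℕ} {x y : Fin n → Fin 2} {z : List (Fin 2)}
    (hx : z ∈ errorBall t s x) (hy : z ∈ errorBall t s y) :
    ∃ u ≤ 2 * s, LatticePath (onesBefore x) (onesBefore y) n n t t u := by
  obtain ⟨u, hu, hp⟩ := ((ObtainableFrom.edits hx).alignment (ObtainableFrom.edits hy)).latticePath
    (fun a : Fin 2 => ((a : ℕ) : ℤ)) [] [] 0 0 0 LatticePath.origin
  exact ⟨u, by omega, by simpa [onesBefore] using hp⟩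

end Codes

theorem mainTheorem5 (t s n : ℕ) (ht : 1 ≤ t) (a : ℕ → ℤ)
    (ha : ∀ k : ℕ, (k : ℤ) ≤ 2 * (t : ℤ) + 2 * (s : ℤ) - 2 →
      0 ≤ a k ∧ a k ≤ syndromeBound t s n k) :
    IsDeletionSubstitutionCorrecting t s (goodVTCode t s n a) := by
  intro x hx y hy hxy
  rw [Set.disjoint_left]
  intro z hzx hzy
  obtain ⟨u, hu, hp⟩ := exists_latticePath hzx hzy
  have hF := hx.1.hasSparseSteps
  have hG := hy.1.hasSparseSteps
  have hbound : ∀ l ≤ n, |onesBefore x l - onesBefore y l| ≤ 2 * (t : ℤ) + 2 * (s : ℤ) - 1 := by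
    intro l hl
    refine (hp.abs_le hF hG le_rfl le_rfl l (by omega)).trans ?_
    omega
  have hmoment : ∀ k ≤ 2 * t + 2 * s - 2,
      ∑ l ∈ Finset.range (n + 1), (l : ℤ) ^ k * (onesBefore x l - onesBefore y l) = 0 := by
    intro k hk
    rw [← vtSyndrome_sub_eq_sum]
    refine Int.eq_zero_of_abs_lt_dvd
      ((hy.2 k (by omega)).trans (hx.2 k (by omega)).symm).dvd ?_
    exact Int.lt_add_one_iff.2 (abs_vtSyndrome_sub_le k hbound)
  obtain ⟨e, -, he⟩ := (hp.pathSigns hF hG le_rfl le_rfl).of_eq (sub_self _)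
  rw [max_self] at he
  exact hxy (eq_of_onesBefore_sub_eq_zero fun l hl =>
    (he.mono (by omega)).eq_zero_of_moments_eq_zero hmoment hl)
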